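/- Let $X$ be a Banach space. Suppose that $X$ is uniformly nonsquare, that is, there is $\delta\in(0,1)$ such that for all $x,y\in X$ with $\|x\|=\|y\|=1$ one has $\left\|\frac{x+y}{2}\right\|\le 1-\delta$ or $\left\|\frac{x-y}{2}\right\|\le 1-\delta$. Then $X$ has the fixed point property: for every nonempty closed bounded convex set $C\subseteq X$ and every nonexpansive map $T:C\to C$ (i.e. $\|Tx-Ty\|\le\|x-y\|$ for all $x,y\in C$), there is $x\in C$ with $Tx=x$. -/

import Mathlib

/-- A normed space `X` is *uniformly nonsquare* if there is `δ ∈ (0, 1)` such that for all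
`x, y` in the unit sphere, `‖(x + y) / 2‖ ≤ 1 - δ` or `‖(x - y) / 2‖ ≤ 1 - δ`. -/
def UniformlyNonsquare (X : Type*) [NormedAddCommGroup X] [NormedSpace ℝ X] : Prop :=
  ∃ δ : ℝ, 0 < δ ∧ δ < 1 ∧ ∀ x y : X, ‖x‖ = 1 → ‖y‖ = 1 →
    ‖(2⁻¹ : ℝ) • (x + y)‖ ≤ 1 - δ ∨ ‖(2⁻¹ : ℝ) • (x - y)‖ ≤ 1 - δ

/-- A normed space `X` has the *fixed point property* if every nonexpansive self-map of every
nonempty closed bounded convex subset `C` of `X` has a fixed point in `C`.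
The self-map is given as a map on `X` of which only the restriction to `C` matters. -/
def HasFixedPointProperty (X : Type*) [NormedAddCommGroup X] [NormedSpace ℝ X] : Prop :=
  ∀ C : Set X, C.Nonempty → IsClosed C → Bornology.IsBounded C → Convex ℝ C →
    ∀ T : X → X, Set.MapsTo T C C → (∀ x ∈ C, ∀ y ∈ C, ‖T x - T y‖ ≤ ‖x - y‖) →
      ∃ x ∈ C, T x = x

set_option maxSynthPendingDepth 3

open Filter Topology Metric NormedSpace

section NormedSpaceTheory

variable {X : Type*} [NormedAddCommGroup X] [NormedSpace ℝ X]

/-! Nonsquareness is used twice. First it gives reflexivity. For `Φ` in the bidual but outside `X`,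
alternating sums of vectors tending weak-star to `Φ`, measured modulo `Φ`, have infima `K n` that
are positive and grow at most linearly, so `K n / K (n + 1)` is close to 1 or larger for some `n`.
Interlacing two near-minimal sums then gives `x`, `y` with `x + y` and `x - y` both too long
(`exists_of_alternatingGT`, `alternatingGT_zero_nonsquare`).

Reflexivity yields a minimal invariant convex set, of diameter `d` say. If `d > 0`, Goebel–Karlovitz
keeps approximate fixed points nearly `d` away from any given point. Let approximate fixed points `x
n` tend weakly to `o`, and solve `z n = (1 - t) T (z n) + t (x n + o) / 2` for one small `t`; let
`y` be the weak limit of `z n`. Then `z n - z m` and `y - o` have norm at most `d / 2`, while for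
suitable `n`, `m` their sum and difference have norm nearly `d`, against nonsquareness. -/

/-- The uniformly nonsquare inequality for arbitrary vectors of norm at most `r`. -/
theorem UniformlyNonsquare.exists_forall_norm_le (hX : UniformlyNonsquare X) :
    ∃ s : ℝ, 0 < s ∧ s < 1 ∧ ∀ (x y : X) (r : ℝ), ‖x‖ ≤ r → ‖y‖ ≤ r →
      ‖x + y‖ ≤ (2 - s) * r ∨ ‖x - y‖ ≤ (2 - s) * r := by
  obtain ⟨δ, hδ, hδ1, h⟩ := hX
  refine ⟨δ / 2, by linarith, by linarith, fun x y r hx hy => ?_⟩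
  have hr : 0 ≤ r := (norm_nonneg x).trans hx
  by_contra! hc
  obtain ⟨h1, h2⟩ := hc
  have hr0 : 0 < r := by
    rcases hr.lt_or_eq with h0 | h0
    · exact h0
    · subst h0
      have := norm_add_le x y
      nlinarith
  -- Both norms are near `r`, so normalising costs less than `δ * r`, half of the gain `2 * δ * r`.
  have hxl : (1 - δ / 2) * r < ‖x‖ := by nlinarith [norm_add_le x y]
  have hyl : (1 - δ / 2) * r < ‖y‖ := by nlinarith [norm_add_le x y]
  have hx0 : 0 < ‖x‖ := lt_of_le_of_lt (by nlinarith) hxl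
  have hy0 : 0 < ‖y‖ := lt_of_le_of_lt (by nlinarith) hyl
  have key : ∀ z : X, 0 < ‖z‖ → ‖z‖ ≤ r → ‖z - (r * ‖z‖⁻¹) • z‖ = r - ‖z‖ := by
    intro z hz hzr
    have : z - (r * ‖z‖⁻¹) • z = (1 - r * ‖z‖⁻¹) • z := by module
    rw [this, norm_smul, Real.norm_eq_abs, abs_of_nonpos]
    · field_simp; ring
    · rw [sub_nonpos, ← div_eq_mul_inv, one_le_div hz]; exact hzr
  have kx := key x hx0 hx
  have ky := key y hy0 hy
  have e1 : ‖x + y‖ ≤ r * ‖‖x‖⁻¹ • x + ‖y‖⁻¹ • y‖ + ((r - ‖x‖) + (r - ‖y‖)) := by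
    rw [← kx, ← ky]
    calc ‖x + y‖ = ‖r • (‖x‖⁻¹ • x + ‖y‖⁻¹ • y)
          + ((x - (r * ‖x‖⁻¹) • x) + (y - (r * ‖y‖⁻¹) • y))‖ := by congr 1; module
      _ ≤ _ := by
        refine (norm_add_le _ _).trans (add_le_add ?_ (norm_add_le _ _))
        rw [norm_smul, Real.norm_of_nonneg hr]
  have e2 : ‖x - y‖ ≤ r * ‖‖x‖⁻¹ • x - ‖y‖⁻¹ • y‖ + ((r - ‖x‖) + (r - ‖y‖)) := by
    rw [← kx, ← ky]
    calc ‖x - y‖ = ‖r • (‖x‖⁻¹ • x - ‖y‖⁻¹ • y)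
          + ((x - (r * ‖x‖⁻¹) • x) - (y - (r * ‖y‖⁻¹) • y))‖ := by congr 1; module
      _ ≤ _ := by
        refine (norm_add_le _ _).trans (add_le_add ?_ (norm_sub_le _ _))
        rw [norm_smul, Real.norm_of_nonneg hr]
  have hnx : ‖‖x‖⁻¹ • x‖ = 1 := by rw [norm_smul, norm_inv, norm_norm, inv_mul_cancel₀ hx0.ne']
  have hny : ‖‖y‖⁻¹ • y‖ = 1 := by rw [norm_smul, norm_inv, norm_norm, inv_mul_cancel₀ hy0.ne']
  have := h _ _ hnx hny
  rw [norm_smul, norm_smul, Real.norm_of_nonneg (by norm_num)] at this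
  rcases this with h3 | h3
  · have := mul_le_mul_of_nonneg_left h3 hr
    nlinarith
  · have := mul_le_mul_of_nonneg_left h3 hr
    nlinarith

/-! ### Weak-star neighbourhoods in the bidual -/

/-- The trace on the ball of radius `‖Φ‖` of `X` of the weak-star neighbourhoods of `Φ`. -/
noncomputable def bidualNhds (Φ : StrongDual ℝ (StrongDual ℝ X)) : Filter X :=
  comap (fun x (f : StrongDual ℝ X) => f x) (𝓝 fun f => Φ f) ⊓ 𝓟 (closedBall 0 ‖Φ‖)

section bidualNhds

variable (Φ : StrongDual ℝ (StrongDual ℝ X))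

theorem tendsto_apply_bidualNhds (f : StrongDual ℝ X) :
    Tendsto (fun x => f x) (bidualNhds Φ) (𝓝 (Φ f)) := by
  have h : Tendsto (fun x (f : StrongDual ℝ X) => f x) (bidualNhds Φ) (𝓝 fun f => Φ f) :=
    tendsto_comap.mono_left inf_le_left
  exact tendsto_pi_nhds.1 h f

theorem eventually_norm_le_bidualNhds : ∀ᶠ x in bidualNhds Φ, ‖x‖ ≤ ‖Φ‖ := by
  filter_upwards [mem_inf_of_right (mem_principal_self (closedBall (0 : X) ‖Φ‖))] with x hx
  simpa using hx

theorem tendsto_bidualNhds {ι : Type*} {l : Filter ι} {g : ι → X}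
    (h1 : ∀ f : StrongDual ℝ X, Tendsto (fun i => f (g i)) l (𝓝 (Φ f)))
    (h2 : ∀ᶠ i in l, ‖g i‖ ≤ ‖Φ‖) : Tendsto g l (bidualNhds Φ) := by
  refine tendsto_inf.2 ⟨tendsto_comap_iff.2 (tendsto_pi_nhds.2 h1), tendsto_principal.2 ?_⟩
  filter_upwards [h2] with i hi
  simpa using hi

theorem tendsto_midpoint_bidualNhds :
    Tendsto (fun p : X × X => (2⁻¹ : ℝ) • (p.1 + p.2)) (bidualNhds Φ ×ˢ bidualNhds Φ)
      (bidualNhds Φ) := by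
  refine tendsto_bidualNhds Φ (fun f => ?_) ?_
  · have h1 : Tendsto (fun p : X × X => f p.1) (bidualNhds Φ ×ˢ bidualNhds Φ) (𝓝 (Φ f)) :=
      (tendsto_apply_bidualNhds Φ f).comp tendsto_fst
    have h2 : Tendsto (fun p : X × X => f p.2) (bidualNhds Φ ×ˢ bidualNhds Φ) (𝓝 (Φ f)) :=
      (tendsto_apply_bidualNhds Φ f).comp tendsto_snd
    have h3 := (h1.add h2).const_mul (2⁻¹ : ℝ)
    rw [show (2⁻¹ : ℝ) * (Φ f + Φ f) = Φ f by ring] at h3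
    simpa [mul_add] using h3
  · filter_upwards [(eventually_norm_le_bidualNhds Φ).prod_mk (eventually_norm_le_bidualNhds Φ)]
      with p hp
    rw [norm_smul, Real.norm_of_nonneg (by norm_num)]
    linarith [norm_add_le p.1 p.2, hp.1, hp.2]

theorem eventually_eventually_midpoint {P : X → Prop} (h : ∀ᶠ u in bidualNhds Φ, P u) :
    ∀ᶠ w in bidualNhds Φ, ∀ᶠ v in bidualNhds Φ, P ((2⁻¹ : ℝ) • (w + v)) :=
  ((tendsto_midpoint_bidualNhds Φ).eventually h).curry

/-- **Goldstine's theorem** on finitely many functionals. -/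
theorem mem_closure_image_closedBall {ι : Type*} [Fintype ι] (f : ι → StrongDual ℝ X) :
    (fun i => Φ (f i)) ∈ closure ((fun x i => f i x) '' closedBall (0 : X) ‖Φ‖) := by
  classical
  by_contra hc
  let L : X →ₗ[ℝ] (ι → ℝ) := LinearMap.pi fun i => (f i).toLinearMap
  have hconv : Convex ℝ (closure ((fun x i => f i x) '' closedBall (0 : X) ‖Φ‖)) :=
    ((convex_closedBall (0 : X) ‖Φ‖).linear_image L).closure
  obtain ⟨ℓ, u, h1, h2⟩ := geometric_hahn_banach_closed_point hconv isClosed_closure hc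
  -- The separating functional pulls back to `g`, with `‖g‖ * ‖Φ‖ ≤ u < Φ g`.
  let g : StrongDual ℝ X := ∑ i, ℓ (Pi.single i 1) • f i
  have hℓ : ∀ a : ι → ℝ, ℓ a = ∑ i, ℓ (Pi.single i 1) * a i := by
    intro a
    conv_lhs => rw [pi_eq_sum_univ' a]
    rw [map_sum]
    refine Finset.sum_congr rfl fun i _ => ?_
    rw [map_smul, smul_eq_mul, mul_comm]
  have hg : ∀ x, g x = ℓ (fun i => f i x) := by
    intro x
    rw [hℓ]
    simp [g]
  have hΦ : Φ g = ℓ (fun i => Φ (f i)) := by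
    rw [hℓ]
    simp [g]
  have hball : ∀ x : X, ‖x‖ ≤ ‖Φ‖ → g x < u := fun x hx => by
    rw [hg]
    exact h1 _ (subset_closure ⟨x, by simpa using hx, rfl⟩)
  have hΦn : 0 ≤ ‖Φ‖ := norm_nonneg Φ
  have hu : 0 < u := by simpa using hball 0 (by simp)
  have hle : Φ g ≤ ‖Φ‖ * ‖g‖ := (le_abs_self _).trans (Φ.le_opNorm g)
  rw [← hΦ] at h2
  have hΦ0 : 0 < ‖Φ‖ := by
    refine lt_of_le_of_ne hΦn fun h => ?_
    rw [← h] at hle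
    linarith
  have hgu : ‖g‖ ≤ u / ‖Φ‖ := by
    refine g.opNorm_le_of_unit_norm (by positivity) fun x hx => ?_
    have a1 := hball (‖Φ‖ • x) (by rw [norm_smul, hx, Real.norm_of_nonneg hΦn, mul_one])
    have a2 := hball (-(‖Φ‖ • x)) (by rw [norm_neg, norm_smul, hx, Real.norm_of_nonneg hΦn, mul_one])
    rw [map_neg] at a2
    rw [map_smul, smul_eq_mul] at a1 a2
    rw [Real.norm_eq_abs, abs_le]
    constructor
    · rw [neg_le, le_div_iff₀ hΦ0]
      linarith
    · rw [le_div_iff₀ hΦ0]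
      linarith
  rw [le_div_iff₀ hΦ0] at hgu
  linarith

instance bidualNhds_neBot : (bidualNhds Φ).NeBot := by
  refine inf_principal_neBot_iff.2 fun U hU => ?_
  obtain ⟨V, hV, hVU⟩ := mem_comap.1 hU
  rw [nhds_pi, mem_pi] at hV
  obtain ⟨I, hI, t, ht, htV⟩ := hV
  have := hI.fintype
  have hmem := mem_closure_image_closedBall Φ (fun i : I => (i : StrongDual ℝ X))
  have hnhds : Set.pi Set.univ (fun i : I => t i) ∈ 𝓝 (fun i : I => Φ (i : StrongDual ℝ X)) :=
    set_pi_mem_nhds Set.finite_univ fun i _ => ht i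
  obtain ⟨_, hz, x, hx, rfl⟩ := mem_closure_iff_nhds.1 hmem _ hnhds
  exact ⟨x, hVU (htV fun i hi => hz ⟨i, hi⟩ trivial), hx⟩

end bidualNhds

/-! ### Alternating sums modulo `Φ` -/

section alternating

variable (Φ : StrongDual ℝ (StrongDual ℝ X))

/-- `AlternatingGT Φ k v r` expresses that
`liminf_{w₁ → Φ} ⋯ liminf_{wₖ → Φ} N (wₖ - wₖ₋₁ + ⋯ ± w₁ ∓ v)` exceeds `r`, where `N` is the
norm of a vector as a functional on the kernel of `Φ`. -/
def AlternatingGT : ℕ → X → ℝ → Prop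
  | 0, v, r => ∃ f : StrongDual ℝ X, ‖f‖ ≤ 1 ∧ Φ f = 0 ∧ r < f v
  | k + 1, v, r => ∀ᶠ w in bidualNhds Φ, AlternatingGT k (w - v) r

variable {Φ}

theorem AlternatingGT.mono {k : ℕ} {v : X} {r r' : ℝ} (h : AlternatingGT Φ k v r) (hr : r' ≤ r) :
    AlternatingGT Φ k v r' := by
  induction k generalizing v with
  | zero => obtain ⟨f, h1, h2, h3⟩ := h; exact ⟨f, h1, h2, hr.trans_lt h3⟩
  | succ k ih => exact Eventually.mono h fun w hw => ih hw

theorem AlternatingGT.le_norm_add {k : ℕ} {v : X} {r : ℝ} (h : AlternatingGT Φ k v r) :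
    r ≤ ‖v‖ + k * ‖Φ‖ := by
  induction k generalizing v with
  | zero =>
    obtain ⟨f, h1, -, h3⟩ := h
    have := f.le_of_opNorm_le h1 v
    have := le_abs_self (f v)
    rw [Real.norm_eq_abs] at *
    simp only [Nat.cast_zero, zero_mul, add_zero]
    linarith
  | succ k ih =>
    obtain ⟨w, hw, hw'⟩ := (Eventually.and h (eventually_norm_le_bidualNhds Φ)).exists
    have := ih hw
    have := norm_sub_le w v
    push_cast
    linarith

/-- The sum from `b` runs one choice ahead. At each step `(a + b) / 2` receives the midpoint of `w`
and `v`, and `(a + v - b) / 2` that of `w` and the next `v`. Midpoints still tend to `Φ`, so both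
lower bounds survive. -/
theorem exists_of_alternatingGT {A α γ : ℝ} (k : ℕ) (a b : X)
    (ha : ¬ AlternatingGT Φ k a A) (hb : ¬ AlternatingGT Φ (k + 1) b A)
    (hα : ∀ᶠ v in bidualNhds Φ, AlternatingGT Φ k ((2⁻¹ : ℝ) • (a + v - b)) α)
    (hγ : AlternatingGT Φ k ((2⁻¹ : ℝ) • (a + b)) γ) :
    ∃ x y : X, ¬ AlternatingGT Φ 0 x A ∧ ¬ AlternatingGT Φ 0 y A ∧
      AlternatingGT Φ 0 ((2⁻¹ : ℝ) • (x + y)) α ∧ AlternatingGT Φ 0 ((2⁻¹ : ℝ) • (x - y)) γ := by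
  induction k generalizing a b with
  | zero =>
    obtain ⟨f, h1, h2, h3⟩ := hγ
    -- The surplus last choice `v` is harmless, since `f v` tends to `Φ f = 0`.
    have ht : Tendsto (fun v => f ((2⁻¹ : ℝ) • (a + b)) - 2⁻¹ * f v) (bidualNhds Φ)
        (𝓝 (f ((2⁻¹ : ℝ) • (a + b)))) := by
      simpa [h2] using ((tendsto_apply_bidualNhds Φ f).const_mul (2⁻¹ : ℝ)).const_sub
        (f ((2⁻¹ : ℝ) • (a + b)))
    obtain ⟨v, hv1, hv2, hv3⟩ := (Frequently.and_eventually (not_eventually.1 hb)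
      (hα.and (ht.eventually_const_lt h3))).exists
    refine ⟨a, v - b, ha, hv1, by rwa [← add_sub_assoc], f, h1, h2, ?_⟩
    convert! hv3 using 1
    simp only [map_smul, map_add, map_sub, smul_eq_mul]
    ring
  | succ k ih =>
    obtain ⟨v, hv1, hv2, hv3⟩ := (Frequently.and_eventually (not_eventually.1 hb)
      (hα.and (eventually_eventually_midpoint Φ hγ))).exists
    obtain ⟨w, hw1, hw2, hw3⟩ := (Frequently.and_eventually (not_eventually.1 ha)
      ((eventually_eventually_midpoint Φ hv2).and hv3)).exists
    refine ih (w - a) (v - b) hw1 hv1 (hw2.mono fun u hu => ?_) ?_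
    · convert hu using 1
      module
    · convert hw3 using 1
      module

/-- By Hahn–Banach, the norm on the kernel of `Φ` is the distance to the line through `Φ`. -/
theorem exists_norm_sub_smul_le (hΦ : Φ ≠ 0) {x : X} {A : ℝ} (hA : 0 ≤ A)
    (hx : ¬ AlternatingGT Φ 0 x A) : ∃ t : ℝ, ‖inclusionInDoubleDual ℝ X x - t • Φ‖ ≤ A := by
  have hx' : ∀ f : StrongDual ℝ X, ‖f‖ ≤ 1 → Φ f = 0 → f x ≤ A := fun f h1 h2 =>
    not_lt.1 fun h3 => hx ⟨f, h1, h2, h3⟩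
  let E : Submodule ℝ (StrongDual ℝ X) := LinearMap.ker Φ.toLinearMap
  have hE : ∀ f : E, Φ f = 0 := fun f => f.2
  let ξ : StrongDual ℝ E := (inclusionInDoubleDual ℝ X x).comp E.subtypeL
  have hξ : ‖ξ‖ ≤ A := by
    refine ξ.opNorm_le_of_unit_norm hA fun f hf => ?_
    have hf' : ‖(f : StrongDual ℝ X)‖ = 1 := hf
    rw [Real.norm_eq_abs, abs_le]
    have h1 : (f : StrongDual ℝ X) x ≤ A := hx' f hf'.le (hE f)
    have h2 : (-(f : StrongDual ℝ X)) x ≤ A :=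
      hx' (-f) (by rw [norm_neg, hf']) (by rw [map_neg, hE, neg_zero])
    have h3 : ξ f = (f : StrongDual ℝ X) x := rfl
    rw [neg_apply] at h2
    rw [h3]
    constructor <;> linarith
  obtain ⟨g, hg, hgn⟩ := exists_extension_norm_eq E ξ
  obtain ⟨f₀, hf₀⟩ : ∃ f, Φ f ≠ 0 := by
    by_contra! h
    exact hΦ (ContinuousLinearMap.ext h)
  refine ⟨(f₀ x - g f₀) / Φ f₀, ?_⟩
  have : inclusionInDoubleDual ℝ X x - ((f₀ x - g f₀) / Φ f₀) • Φ = g := by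
    ext f
    have hf : Φ (f - (Φ f / Φ f₀) • f₀) = 0 := by
      rw [map_sub, map_smul, smul_eq_mul, div_mul_cancel₀ _ hf₀, sub_self]
    have h1 := hg ⟨f - (Φ f / Φ f₀) • f₀, hf⟩
    have h2 : ξ ⟨f - (Φ f / Φ f₀) • f₀, hf⟩ = f x - (Φ f / Φ f₀) * f₀ x := rfl
    rw [h2, map_sub, map_smul, smul_eq_mul] at h1
    simp only [sub_apply, smul_apply, dual_def, smul_eq_mul]
    field_simp at h1 ⊢
    linarith
  rw [this, hgn]
  exact hξ

/-- Corrected by multiples of `Φ`, `x` and `y` have bidual norm at most `A`. Goldstine replaces them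
by vectors of `X` without spoiling the values at `f` and `g`. -/
theorem alternatingGT_zero_nonsquare {s : ℝ}
    (hs : ∀ (x y : X) (r : ℝ), ‖x‖ ≤ r → ‖y‖ ≤ r →
      ‖x + y‖ ≤ (2 - s) * r ∨ ‖x - y‖ ≤ (2 - s) * r)
    (hΦ : Φ ≠ 0) {x y : X} {A : ℝ} (hA : 0 ≤ A) (hx : ¬ AlternatingGT Φ 0 x A)
    (hy : ¬ AlternatingGT Φ 0 y A)
    (h1 : AlternatingGT Φ 0 ((2⁻¹ : ℝ) • (x + y)) ((1 - s / 2) * A))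
    (h2 : AlternatingGT Φ 0 ((2⁻¹ : ℝ) • (x - y)) ((1 - s / 2) * A)) : False := by
  obtain ⟨t, ht⟩ := exists_norm_sub_smul_le hΦ hA hx
  obtain ⟨u, hu⟩ := exists_norm_sub_smul_le hΦ hA hy
  obtain ⟨f, f1, f2, f3⟩ := h1
  obtain ⟨g, g1, g2, g3⟩ := h2
  set ξ := inclusionInDoubleDual ℝ X x - t • Φ
  set η := inclusionInDoubleDual ℝ X y - u • Φ
  have tf : Tendsto (fun p : X × X => f p.1 + f p.2) (bidualNhds ξ ×ˢ bidualNhds η)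
      (𝓝 (ξ f + η f)) :=
    ((tendsto_apply_bidualNhds ξ f).comp tendsto_fst).add
      ((tendsto_apply_bidualNhds η f).comp tendsto_snd)
  have tg : Tendsto (fun p : X × X => g p.1 - g p.2) (bidualNhds ξ ×ˢ bidualNhds η)
      (𝓝 (ξ g - η g)) :=
    ((tendsto_apply_bidualNhds ξ g).comp tendsto_fst).sub
      ((tendsto_apply_bidualNhds η g).comp tendsto_snd)
  have ef : (2 - s) * A < ξ f + η f := by
    simp [ξ, η, f2] at f3 ⊢
    linarith
  have eg : (2 - s) * A < ξ g - η g := by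
    simp [ξ, η, g2] at g3 ⊢
    linarith
  obtain ⟨p, ⟨p1, p2⟩, p3, p4⟩ := (((eventually_norm_le_bidualNhds ξ).prod_mk
    (eventually_norm_le_bidualNhds η)).and
      ((tf.eventually_const_lt ef).and (tg.eventually_const_lt eg))).exists
  have bound : ∀ h : StrongDual ℝ X, ‖h‖ ≤ 1 → ∀ z, h z ≤ ‖z‖ := fun h hh z => by
    simpa using (le_abs_self _).trans (h.le_of_opNorm_le hh z)
  rcases hs p.1 p.2 A (p1.trans ht) (p2.trans hu) with h | h
  · have := bound f f1 (p.1 + p.2)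
    rw [map_add] at this
    linarith
  · have := bound g g1 (p.1 - p.2)
    rw [map_sub] at this
    linarith

theorem exists_forall_alternatingGT_one {d : ℝ} (hd : 0 < d)
    (h : ∀ x, d ≤ ‖Φ - inclusionInDoubleDual ℝ X x‖) :
    ∃ r : ℝ, 0 < r ∧ ∀ v, AlternatingGT Φ 1 v r := by
  have hΦn : 0 ≤ ‖Φ‖ := norm_nonneg Φ
  have hΦ : Φ ≠ 0 := by
    rintro rfl
    have := h 0
    simp at this
    linarith
  have hsmul : ∀ x t, |t| * d ≤ ‖inclusionInDoubleDual ℝ X x - t • Φ‖ := by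
    intro x t
    rcases eq_or_ne t 0 with rfl | ht
    · simp
    · have e : inclusionInDoubleDual ℝ X x - t • Φ =
          (-t) • (Φ - inclusionInDoubleDual ℝ X (t⁻¹ • x)) := by
        rw [map_smul, smul_sub, smul_smul, neg_mul, mul_inv_cancel₀ ht]
        module
      rw [e, norm_smul, norm_neg, Real.norm_eq_abs]
      exact mul_le_mul_of_nonneg_left (h _) (abs_nonneg t)
  have hnorm : ∀ x : X, ‖inclusionInDoubleDual ℝ X x‖ = ‖x‖ := fun x =>
    (inclusionInDoubleDualLi ℝ).norm_map x
  -- Chosen so that `r + (r / d) * ‖Φ‖ = d / 2`.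
  refine ⟨d * d / (2 * (d + ‖Φ‖)), by positivity, fun v => ?_⟩
  set r := d * d / (2 * (d + ‖Φ‖)) with hr
  have hr0 : 0 < r := by positivity
  have hrd : r * (d + ‖Φ‖) = d * (d / 2) := by rw [hr]; field_simp
  obtain ⟨f, hf1, hf2⟩ : ∃ f : StrongDual ℝ X, ‖f‖ ≤ 1 ∧
      d / 2 < (Φ - inclusionInDoubleDual ℝ X v) f := by
    by_contra! hc
    have : ‖Φ - inclusionInDoubleDual ℝ X v‖ ≤ d / 2 := by
      refine ContinuousLinearMap.opNorm_le_of_unit_norm (by positivity) fun f hf => ?_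
      have a1 := hc f hf.le
      have a2 := hc (-f) (by rw [norm_neg, hf])
      rw [map_neg] at a2
      rw [Real.norm_eq_abs, abs_le]
      constructor <;> linarith
    linarith [h v]
  have ht : Tendsto (fun w => f w - f v) (bidualNhds Φ) (𝓝 (Φ f - f v)) :=
    (tendsto_apply_bidualNhds Φ f).sub_const _
  filter_upwards [ht.eventually_const_lt hf2] with w hw
  by_contra hc
  obtain ⟨t, ht⟩ := exists_norm_sub_smul_le hΦ hr0.le hc
  have a1 : d / 2 < ‖w - v‖ := by
    rw [← map_sub] at hw
    simpa using hw.trans_le ((le_abs_self _).trans (f.le_of_opNorm_le hf1 (w - v)))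
  have a2 := (hsmul (w - v) t).trans ht
  have a3 : ‖w - v‖ ≤ r + |t| * ‖Φ‖ := by
    rw [← hnorm]
    calc ‖inclusionInDoubleDual ℝ X (w - v)‖
        = ‖(inclusionInDoubleDual ℝ X (w - v) - t • Φ) + t • Φ‖ := by rw [sub_add_cancel]
      _ ≤ _ := (norm_add_le _ _).trans (add_le_add ht (norm_smul_le _ _))
  have a4 : |t| * d * ‖Φ‖ ≤ r * ‖Φ‖ := mul_le_mul_of_nonneg_right a2 hΦn
  nlinarith

end alternating

/-- **James' theorem**: uniformly nonsquare Banach spaces are reflexive. -/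
theorem UniformlyNonsquare.surjective_inclusionInDoubleDual [CompleteSpace X]
    (hX : UniformlyNonsquare X) : Function.Surjective (inclusionInDoubleDual ℝ X) := by
  obtain ⟨s, hs0, hs1, hs⟩ := hX.exists_forall_norm_le
  intro Φ
  by_contra hΦ
  have hclosed : IsClosed (Set.range (inclusionInDoubleDual ℝ X)) :=
    (inclusionInDoubleDualLi (E := X) ℝ).isometry.isClosedEmbedding.isClosed_range
  obtain ⟨d, hd, hball⟩ := Metric.isOpen_iff.1 hclosed.isOpen_compl Φ hΦ
  have hdist : ∀ x, d ≤ ‖Φ - inclusionInDoubleDual ℝ X x‖ := by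
    intro x
    by_contra! hc
    exact hball (by rwa [mem_ball', dist_eq_norm]) ⟨x, rfl⟩
  have hΦ0 : Φ ≠ 0 := by
    rintro rfl
    exact hΦ ⟨0, map_zero _⟩
  obtain ⟨r₀, hr₀, hr₀'⟩ := exists_forall_alternatingGT_one hd hdist
  let S : ℕ → Set ℝ := fun n => {r | ∀ v, AlternatingGT Φ n v r}
  have hS1 : ∀ n, S n ⊆ S (n + 1) := fun n r hr v => Eventually.of_forall fun w => hr _
  have hSr : ∀ n, r₀ ∈ S (n + 1) := by
    intro n
    induction n with
    | zero => exact hr₀'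
    | succ n ih => exact hS1 _ ih
  have hSle : ∀ n, ∀ r ∈ S n, r ≤ n * ‖Φ‖ := fun n r hr => by simpa using (hr 0).le_norm_add
  have hbdd : ∀ n, BddAbove (S n) := fun n => ⟨n * ‖Φ‖, hSle n⟩
  -- Level 0 is skipped: there `v = 0` allows only negative `r`.
  let K : ℕ → ℝ := fun n => sSup (S (n + 1))
  have hK0 : ∀ n, r₀ ≤ K n := fun n => le_csSup (hbdd _) (hSr n)
  have hKle : ∀ n, K n ≤ (n + 1) * ‖Φ‖ := fun n => by
    simpa using csSup_le ⟨r₀, hSr n⟩ (hSle (n + 1))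
  have hlt : ∀ n r, r < K n → ∀ v, AlternatingGT Φ (n + 1) v r := by
    intro n r hr v
    obtain ⟨r', hr', hlt⟩ := exists_lt_of_lt_csSup ⟨r₀, hSr n⟩ hr
    exact (hr' v).mono hlt.le
  have hgt : ∀ n r, K n < r → ∃ v, ¬ AlternatingGT Φ (n + 1) v r := by
    intro n r hr
    by_contra! hc
    exact hr.not_ge (le_csSup (hbdd _) hc)
  -- Being strictly between `1 - s / 2` and 1, `q` leaves room for both `K (n + 1) < A` and `(1 - s
  -- / 2) * A < K (n + 1)`.
  set q := 1 - s / 4 with hq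
  obtain ⟨n, hn⟩ : ∃ n, q * K (n + 1) < K n := by
    by_contra! hc
    have hpow : ∀ n, r₀ ≤ q ^ n * K n := by
      intro n
      induction n with
      | zero => simpa using hK0 0
      | succ n ih =>
        rw [pow_succ, mul_assoc]
        exact ih.trans (mul_le_mul_of_nonneg_left (hc n) (pow_nonneg (by linarith) n))
    have ht : Tendsto (fun n : ℕ => ((n : ℝ) * q ^ n + q ^ n) * ‖Φ‖) atTop (𝓝 ((0 + 0) * ‖Φ‖)) :=
      ((tendsto_self_mul_const_pow_of_lt_one (by linarith) (by linarith)).add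
        (tendsto_pow_atTop_nhds_zero_of_lt_one (by linarith) (by linarith))).mul_const _
    have : r₀ ≤ (0 + 0) * ‖Φ‖ := ge_of_tendsto' ht fun n => by
      have := mul_le_mul_of_nonneg_left (hKle n) (pow_nonneg (show (0 : ℝ) ≤ q by linarith) n)
      linarith [hpow n]
    linarith
  have hK1 : 0 < K (n + 1) := hr₀.trans_le (hK0 _)
  have hp : 0 < 1 - s / 2 := by linarith
  set A := q * K (n + 1) / (1 - s / 2) with hA
  have hpA : (1 - s / 2) * A = q * K (n + 1) := by rw [hA, mul_div_cancel₀ _ hp.ne']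
  have hAK : K (n + 1) < A := by
    rw [hA, lt_div_iff₀ hp]
    nlinarith
  obtain ⟨a, ha⟩ := hgt (n + 1) A hAK
  have hα := hlt (n + 1) ((1 - s / 2) * A) (by rw [hpA]; nlinarith)
  have hγ := hlt n ((1 - s / 2) * A) (by rw [hpA]; exact hn)
  obtain ⟨w, hw1, hw2⟩ := (Frequently.and_eventually (not_eventually.1 ha)
    (eventually_eventually_midpoint Φ (hα a))).exists
  obtain ⟨x, y, hx, hy, h1, h2⟩ := exists_of_alternatingGT (n + 1) (w - a) a hw1 ha
    (hw2.mono fun v hv => by convert hv using 1; module) (hγ _)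
  exact alternatingGT_zero_nonsquare hs hΦ0 (hK1.trans hAK).le hx hy h1 h2

/-! ### Weak compactness -/

/-- The sequential form of the Banach–Alaoglu theorem along ultrafilters. -/
theorem exists_tendsto_apply_of_norm_le {ι : Type*} (U : Ultrafilter ι) {f : ι → StrongDual ℝ X}
    {R : ℝ} (hf : ∀ i, ‖f i‖ ≤ R) :
    ∃ g : StrongDual ℝ X, ∀ x, Tendsto (fun i => f i x) U (𝓝 (g x)) := by
  have hc := WeakDual.isCompact_closedBall (𝕜 := ℝ) (E := X) 0 R
  obtain ⟨g, -, hg⟩ := hc.ultrafilter_le_nhds (U.map fun i => StrongDual.toWeakDual (f i)) (by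
    rw [le_principal_iff]
    exact mem_map.2 (univ_mem' fun i => by simpa using hf i))
  refine ⟨WeakDual.toStrongDual g, fun x => ?_⟩
  exact ((WeakDual.eval_continuous x).tendsto g).comp hg

/-- Bounded families in a reflexive space converge weakly along ultrafilters. -/
theorem exists_tendsto_apply_of_surjective
    (hX : Function.Surjective (inclusionInDoubleDual ℝ X)) {ι : Type*} (U : Ultrafilter ι)
    {x : ι → X} {R : ℝ} (hx : ∀ i, ‖x i‖ ≤ R) :
    ∃ y : X, ∀ f : StrongDual ℝ X, Tendsto (fun i => f (x i)) U (𝓝 (f y)) := by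
  obtain ⟨Φ, hΦ⟩ := exists_tendsto_apply_of_norm_le U
    (f := fun i => inclusionInDoubleDual ℝ X (x i)) (R := R)
    fun i => (double_dual_bound ℝ X (x i)).trans (hx i)
  obtain ⟨y, rfl⟩ := hX Φ
  exact ⟨y, hΦ⟩

theorem mem_of_tendsto_apply {ι : Type*} {l : Filter ι} [l.NeBot] {x : ι → X} {y : X}
    (h : ∀ f : StrongDual ℝ X, Tendsto (fun i => f (x i)) l (𝓝 (f y))) {K : Set X}
    (hK : IsClosed K) (hKc : Convex ℝ K) (hx : ∀ᶠ i in l, x i ∈ K) : y ∈ K := by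
  by_contra hy
  obtain ⟨f, u, h1, h2⟩ := geometric_hahn_banach_closed_point hKc hK hy
  have : f y ≤ u := le_of_tendsto (h f) (hx.mono fun i hi => (h1 _ hi).le)
  linarith

theorem norm_le_of_tendsto_apply {ι : Type*} {l : Filter ι} [l.NeBot] {x : ι → X} {y : X}
    (h : ∀ f : StrongDual ℝ X, Tendsto (fun i => f (x i)) l (𝓝 (f y))) {r : ℝ}
    (hx : ∀ᶠ i in l, ‖x i‖ ≤ r) : ‖y‖ ≤ r := by
  simpa using mem_of_tendsto_apply h isClosed_closedBall (convex_closedBall (0 : X) r)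
    (hx.mono fun i hi => by simpa using hi)

/-! ### Minimal invariant sets -/

/-- A nonempty closed convex set invariant under `T`. -/
structure IsInvariantConvex (T : X → X) (K : Set X) : Prop where
  nonempty : K.Nonempty
  isClosed : IsClosed K
  convex : Convex ℝ K
  mapsTo : Set.MapsTo T K K

theorem exists_minimal_isInvariantConvex (hX : Function.Surjective (inclusionInDoubleDual ℝ X))
    {T : X → X} {C : Set X} (hC : IsInvariantConvex T C) (hb : Bornology.IsBounded C) :
    ∃ K ⊆ C, Minimal (IsInvariantConvex T) K := by
  refine zorn_superset_nonempty {K | IsInvariantConvex T K ∧ K ⊆ C} ?_ C ⟨hC, subset_rfl⟩ |>.imp ?_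
  · intro c hc hchain hne
    obtain ⟨R, hR⟩ := hb.exists_norm_le
    have : Nonempty c := hne.to_subtype
    have hdir : Directed (· ≥ ·) (fun K : c => 𝓟 (K : Set X)) := by
      intro K L
      rcases hchain.total K.2 L.2 with h | h
      · exact ⟨K, le_rfl, principal_mono.2 h⟩
      · exact ⟨L, principal_mono.2 h, le_rfl⟩
    have hneBot : (⨅ K : c, 𝓟 (K : Set X)).NeBot :=
      iInf_neBot_of_directed' hdir fun K => principal_neBot_iff.2 (hc K.2).1.nonempty
    let U := Ultrafilter.of (⨅ K : c, 𝓟 (K : Set X))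
    have hU : ∀ K ∈ c, K ∈ U := fun K hK =>
      Ultrafilter.of_le _ (mem_iInf_of_mem (⟨K, hK⟩ : c) (mem_principal_self K))
    obtain ⟨K₀, hK₀⟩ := hne
    have hCU : C ∈ U := mem_of_superset (hU K₀ hK₀) (hc hK₀).2
    classical
    -- `U` contains `C`, so cutting the identity off outside `C` gives boundedness without changing
    -- the limit.
    obtain ⟨y, hy⟩ := exists_tendsto_apply_of_surjective hX U
      (x := fun x => if x ∈ C then x else 0) (R := max R 0) (fun x => by
        split_ifs with h
        · exact (hR x h).trans (le_max_left _ _)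
        · simp)
    refine ⟨⋂₀ c, ⟨⟨⟨y, fun K hK => ?_⟩, isClosed_sInter fun K hK => (hc hK).1.isClosed,
      convex_sInter fun K hK => (hc hK).1.convex, fun x hx K hK => (hc hK).1.mapsTo (hx K hK)⟩,
      (Set.sInter_subset_of_mem hK₀).trans (hc hK₀).2⟩, fun K hK => Set.sInter_subset_of_mem hK⟩
    refine mem_of_tendsto_apply hy (hc hK).1.isClosed (hc hK).1.convex ?_
    filter_upwards [hU K hK, hCU] with x h1 h2
    rwa [if_pos h2]
  · rintro K ⟨hKC, hK⟩
    exact ⟨hKC, hK.prop.1, fun L hL hLK => hK.le_of_le ⟨hL, hLK.trans hKC⟩ hLK⟩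

section minimal

variable {T : X → X} {K : Set X}

theorem Minimal.subset_of_isInvariantConvex (hK : Minimal (IsInvariantConvex T) K) {L : Set X}
    (hne : (K ∩ L).Nonempty) (hL : IsClosed L) (hLc : Convex ℝ L)
    (hTL : ∀ x ∈ K, x ∈ L → T x ∈ L) : K ⊆ L := by
  have h : IsInvariantConvex T (K ∩ L) := ⟨hne, hK.prop.isClosed.inter hL,
    hK.prop.convex.inter hLc, fun x hx => ⟨hK.prop.mapsTo hx.1, hTL x hx.1 hx.2⟩⟩
  exact (hK.le_of_le h Set.inter_subset_left).trans Set.inter_subset_right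

/-- Minimal invariant sets are diametral. -/
theorem Minimal.norm_sub_le_of_isInvariantConvex (hK : Minimal (IsInvariantConvex T) K)
    (hT : ∀ x ∈ K, ∀ y ∈ K, ‖T x - T y‖ ≤ ‖x - y‖) {p : X} (hp : p ∈ K) {r : ℝ}
    (hr : ∀ x ∈ K, ‖x - p‖ ≤ r) : ∀ x ∈ K, ∀ y ∈ K, ‖x - y‖ ≤ r := by
  have hr0 : 0 ≤ r := (norm_nonneg _).trans (hr p hp)
  have e : {y | ∀ x ∈ K, ‖x - y‖ ≤ r} = ⋂ x ∈ K, closedBall x r := by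
    ext y
    simp [dist_eq_norm, norm_sub_rev]
  have key : K ⊆ {y | ∀ x ∈ K, ‖x - y‖ ≤ r} := by
    refine hK.subset_of_isInvariantConvex ⟨p, hp, hr⟩ ?_ ?_ fun y hy hyr => ?_
    · rw [e]
      exact isClosed_biInter fun x _ => isClosed_closedBall
    · rw [e]
      exact convex_iInter₂ fun x _ => convex_closedBall x r
    -- This ball contains `T` of `K`, so minimality puts `K` inside it.
    · have hsub : K ⊆ closedBall (T y) r :=
        hK.subset_of_isInvariantConvex ⟨T y, hK.prop.mapsTo hy, mem_closedBall_self hr0⟩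
          isClosed_closedBall (convex_closedBall _ _) fun x hx _ => by
            rw [mem_closedBall, dist_eq_norm]
            exact (hT x hx y hy).trans (hyr x hx)
      exact fun x hx => by simpa [dist_eq_norm] using hsub hx
  exact fun x hx y hy => key hy x hx

/-- The **Goebel–Karlovitz lemma**. -/
theorem Minimal.norm_sub_le_of_approxFixed (hX : Function.Surjective (inclusionInDoubleDual ℝ X))
    (hK : Minimal (IsInvariantConvex T) K) (hb : Bornology.IsBounded K)
    (hT : ∀ x ∈ K, ∀ y ∈ K, ‖T x - T y‖ ≤ ‖x - y‖) {ι : Type*} {l : Filter ι} [l.NeBot]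
    {x : ι → X} (hx : ∀ i, x i ∈ K) (hTx : Tendsto (fun i => ‖T (x i) - x i‖) l (𝓝 0))
    {p : X} (hp : p ∈ K) {r : ℝ} (hr : ∀ i, ‖x i - p‖ ≤ r) :
    ∀ x ∈ K, ∀ y ∈ K, ‖x - y‖ ≤ r := by
  let U := Ultrafilter.of l
  have hTU : Tendsto (fun i => ‖T (x i) - x i‖) U (𝓝 0) := hTx.mono_left (Ultrafilter.of_le l)
  -- This sublevel set of the limsup of `‖x i - q‖` is closed, convex and invariant. The weak limit
  -- of `x i` is then within `r` of all of `K`, and diametrality applies.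
  have key : K ⊆ {q | ∀ ε > 0, ∀ᶠ i in U, ‖x i - q‖ ≤ r + ε} := by
    refine hK.subset_of_isInvariantConvex
      ⟨p, hp, fun ε hε => Eventually.of_forall fun i => (hr i).trans (by linarith)⟩ ?_ ?_ ?_
    · refine isClosed_of_closure_subset fun q hq ε hε => ?_
      obtain ⟨q', hq', hd⟩ := Metric.mem_closure_iff.1 hq (ε / 2) (by positivity)
      filter_upwards [hq' (ε / 2) (by positivity)] with i hi
      rw [dist_eq_norm, norm_sub_rev] at hd
      have := norm_sub_le_norm_sub_add_norm_sub (x i) q' q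
      linarith
    · intro q hq q' hq' a b ha hb hab ε hε
      filter_upwards [hq ε hε, hq' ε hε] with i h1 h2
      have := convex_closedBall (x i) (r + ε) (x := q) (by simpa [dist_eq_norm, norm_sub_rev] using h1)
        (y := q') (by simpa [dist_eq_norm, norm_sub_rev] using h2) ha hb hab
      rwa [mem_closedBall, dist_eq_norm, norm_sub_rev] at this
    · intro q hqK hq ε hε
      filter_upwards [hq (ε / 2) (by positivity), hTU.eventually_lt_const (half_pos hε)]
        with i h1 h2
      have h3 := hT _ (hx i) _ hqK
      have h4 := norm_sub_le_norm_sub_add_norm_sub (x i) (T (x i)) (T q)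
      rw [norm_sub_rev] at h2
      linarith
  obtain ⟨R, hR⟩ := hb.exists_norm_le
  obtain ⟨y, hy⟩ := exists_tendsto_apply_of_surjective hX U fun i => hR _ (hx i)
  refine hK.norm_sub_le_of_isInvariantConvex hT
    (mem_of_tendsto_apply hy hK.prop.isClosed hK.prop.convex (Eventually.of_forall hx))
    fun q hq => ?_
  refine le_of_forall_pos_le_add fun ε hε => ?_
  rw [norm_sub_rev]
  refine norm_le_of_tendsto_apply (l := (U : Filter ι)) (x := fun i => x i - q) (fun f => ?_)
    (key hq ε hε)
  simpa using (hy f).sub_const (f q)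

theorem Minimal.exists_forall_le_norm_sub (hX : Function.Surjective (inclusionInDoubleDual ℝ X))
    (hK : Minimal (IsInvariantConvex T) K) (hb : Bornology.IsBounded K)
    (hT : ∀ x ∈ K, ∀ y ∈ K, ‖T x - T y‖ ≤ ‖x - y‖) {p : X} (hp : p ∈ K) {r : ℝ}
    (hr : r < diam K) : ∃ ε > 0, ∀ x ∈ K, ‖T x - x‖ ≤ ε → r ≤ ‖x - p‖ := by
  by_contra! hc
  choose x hxK hTx hxp using fun n : ℕ => hc (1 / ((n : ℝ) + 1)) (by positivity)
  have hle := hK.norm_sub_le_of_approxFixed hX hb hT (l := atTop) hxK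
    (squeeze_zero (fun _ => norm_nonneg _) hTx tendsto_one_div_add_atTop_nhds_zero_nat) hp
    fun n => (hxp n).le
  have hr0 : 0 ≤ r := (norm_nonneg _).trans (hxp 0).le
  exact hr.not_ge (diam_le_of_forall_dist_le hr0 fun x hx y hy => by
    rw [dist_eq_norm]
    exact hle x hx y hy)

end minimal

/-! ### Approximate fixed points -/

theorem IsInvariantConvex.exists_eq_combination [CompleteSpace X] {T : X → X} {K : Set X}
    (hK : IsInvariantConvex T K) (hT : ∀ x ∈ K, ∀ y ∈ K, ‖T x - T y‖ ≤ ‖x - y‖)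
    {c : X} (hc : c ∈ K) {t : ℝ} (ht0 : 0 < t) (ht1 : t ≤ 1) :
    ∃ z ∈ K, (1 - t) • T z + t • c = z := by
  have hmaps : Set.MapsTo (fun z => (1 - t) • T z + t • c) K K := fun z hz =>
    hK.convex (hK.mapsTo hz) hc (by linarith) ht0.le (by ring)
  have hcon : ContractingWith (Real.toNNReal (1 - t)) (hmaps.restrict _ K K) := by
    refine ⟨by simpa using ht0, LipschitzWith.of_dist_le_mul ?_⟩
    rintro ⟨z, hz⟩ ⟨w, hw⟩
    rw [Subtype.dist_eq, Subtype.dist_eq]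
    simp only [Set.MapsTo.val_restrict_apply, Real.coe_toNNReal _ (sub_nonneg.2 ht1), dist_add_right]
    rw [dist_smul₀, Real.norm_of_nonneg (by linarith), dist_eq_norm, dist_eq_norm]
    exact mul_le_mul_of_nonneg_left (hT z hz w hw) (by linarith)
  obtain ⟨z, hz, hfix, -⟩ := hcon.exists_fixedPoint' hK.isClosed.isComplete hmaps hc (edist_ne_top _ _)
  exact ⟨z, hz, hfix⟩

/-- One `t` must serve every `c`, as the final argument subtracts equations with different `c`. -/
theorem IsInvariantConvex.exists_norm_sub_le [CompleteSpace X] {T : X → X} {K : Set X}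
    (hK : IsInvariantConvex T K) (hT : ∀ x ∈ K, ∀ y ∈ K, ‖T x - T y‖ ≤ ‖x - y‖)
    {d : ℝ} (hd : ∀ x ∈ K, ∀ y ∈ K, ‖x - y‖ ≤ d) {c : X} (hc : c ∈ K)
    {ε : ℝ} (hε : 0 < ε) : ∃ t : ℝ, 0 < t ∧ t ≤ 1 ∧ ∀ c ∈ K, ∃ z ∈ K, (1 - t) • T z + t • c = z ∧
      ‖T z - z‖ ≤ ε := by
  have hd0 : 0 ≤ d := (norm_nonneg _).trans (hd c hc c hc)
  refine ⟨min 1 (ε / (d + 1)), by positivity, min_le_left _ _, fun c hc => ?_⟩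
  set t := min 1 (ε / (d + 1)) with ht
  have ht0 : 0 < t := by positivity
  obtain ⟨z, hz, hfix⟩ := hK.exists_eq_combination hT hc ht0 (min_le_left _ _)
  refine ⟨z, hz, hfix, ?_⟩
  have e : T z - z = t • (T z - c) := by
    nth_rw 2 [← hfix]
    module
  have h1 := hd _ (hK.mapsTo hz) _ hc
  have h2 : t * (d + 1) ≤ ε := (le_div_iff₀ (by positivity)).1 (min_le_right _ _)
  rw [e, norm_smul, Real.norm_of_nonneg ht0.le]
  nlinarith

end NormedSpaceTheory

/-! ### The fixed point property -/

theorem mainTheorem2 {X : Type*} [NormedAddCommGroup X] [NormedSpace ℝ X] [CompleteSpace X]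
    (hX : UniformlyNonsquare X) : HasFixedPointProperty X := by
  intro C hCne hCcl hCb hCc T hTC hT
  have hrefl := hX.surjective_inclusionInDoubleDual
  obtain ⟨s, hs0, hs1, hs⟩ := hX.exists_forall_norm_le
  obtain ⟨K, hKC, hK⟩ := exists_minimal_isInvariantConvex hrefl ⟨hCne, hCcl, hCc, hTC⟩ hCb
  have hKb := hCb.subset hKC
  replace hT : ∀ x ∈ K, ∀ y ∈ K, ‖T x - T y‖ ≤ ‖x - y‖ := fun x hx y hy =>
    hT x (hKC hx) y (hKC hy)
  obtain ⟨c, hc⟩ := hK.prop.nonempty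
  set d := diam K with hd
  have hdle : ∀ x ∈ K, ∀ y ∈ K, ‖x - y‖ ≤ d := fun x hx y hy => by
    rw [← dist_eq_norm]
    exact dist_le_diam_of_mem hKb hx hy
  rcases (diam_nonneg (s := K)).eq_or_lt with hd0 | hd0
  · refine ⟨c, hKC hc, sub_eq_zero.1 (norm_le_zero_iff.1 ?_)⟩
    exact (hdle _ (hK.prop.mapsTo hc) _ hc).trans hd0.ge
  exfalso
  rw [← hd] at hd0
  obtain ⟨R, hR⟩ := hKb.exists_norm_le
  have hU : ((hyperfilter ℕ : Ultrafilter ℕ) : Filter ℕ) ≤ atTop := Nat.hyperfilter_le_atTop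
  generalize hyperfilter ℕ = U at hU
  have hx : ∀ n : ℕ, ∃ x ∈ K, ‖T x - x‖ ≤ 1 / ((n : ℝ) + 1) := fun n => by
    obtain ⟨t, -, -, h⟩ := hK.prop.exists_norm_sub_le hT hdle hc (ε := 1 / ((n : ℝ) + 1))
      (by positivity)
    obtain ⟨z, hz, -, hz'⟩ := h c hc
    exact ⟨z, hz, hz'⟩
  choose x hxK hTx using hx
  have hTx0 : Tendsto (fun n => ‖T (x n) - x n‖) U (𝓝 0) :=
    (squeeze_zero (fun _ => norm_nonneg _) hTx tendsto_one_div_add_atTop_nhds_zero_nat).mono_left hU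
  obtain ⟨o, ho⟩ := exists_tendsto_apply_of_surjective hrefl U fun n => hR _ (hxK n)
  have hoK : o ∈ K :=
    mem_of_tendsto_apply ho hK.prop.isClosed hK.prop.convex (Eventually.of_forall hxK)
  -- Thus `(2 - s) * (d / 2) = d - 4 * η`, while the errors below total `2 * η`.
  set η := s * d / 8 with hη
  have hη0 : 0 < η := by positivity
  obtain ⟨ε, hε, hfar⟩ := hK.exists_forall_le_norm_sub hrefl hKb hT hoK (r := d - η) (by linarith)
  obtain ⟨t, ht0, ht1, ht⟩ := hK.prop.exists_norm_sub_le hT hdle hc hε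
  have hmid : ∀ n, (2⁻¹ : ℝ) • x n + (2⁻¹ : ℝ) • o ∈ K := fun n =>
    hK.prop.convex (hxK n) hoK (by norm_num) (by norm_num) (by norm_num)
  choose z hzK hz hTz using fun n => ht _ (hmid n)
  have hzo : ∀ n, d - η ≤ ‖z n - o‖ := fun n => hfar _ (hzK n) (hTz n)
  have hzz : ∀ n m, ‖z n - z m‖ ≤ d / 2 := by
    intro n m
    have e : z n - z m = (1 - t) • (T (z n) - T (z m)) + (t * 2⁻¹) • (x n - x m) := by
      nth_rw 1 [← hz n, ← hz m]
      module
    have h1 := norm_add_le ((1 - t) • (T (z n) - T (z m))) ((t * 2⁻¹) • (x n - x m))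
    rw [← e, norm_smul, norm_smul, Real.norm_of_nonneg (by linarith),
      Real.norm_of_nonneg (by positivity)] at h1
    have h2 := mul_le_mul_of_nonneg_left (hT _ (hzK n) _ (hzK m)) (sub_nonneg.2 ht1)
    have h3 := mul_le_mul_of_nonneg_left (hdle _ (hxK n) _ (hxK m)) ht0.le
    refine le_of_mul_le_mul_left ?_ ht0
    linarith
  have hzx : ∀ n, t * ‖z n - x n‖ ≤ t * (d / 2) + ‖T (x n) - x n‖ := by
    intro n
    have e : z n - x n = (1 - t) • ((T (z n) - T (x n)) + (T (x n) - x n))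
        + (t * 2⁻¹) • (o - x n) := by
      nth_rw 1 [← hz n]
      module
    have h1 := norm_add_le ((1 - t) • ((T (z n) - T (x n)) + (T (x n) - x n)))
      ((t * 2⁻¹) • (o - x n))
    rw [← e, norm_smul, norm_smul, Real.norm_of_nonneg (by linarith),
      Real.norm_of_nonneg (by positivity)] at h1
    have h2 := mul_le_mul_of_nonneg_left ((norm_add_le (T (z n) - T (x n)) (T (x n) - x n)).trans
      (add_le_add_left (hT _ (hzK n) _ (hxK n)) _)) (sub_nonneg.2 ht1)
    have h3 := mul_le_mul_of_nonneg_left (hdle _ hoK _ (hxK n)) ht0.le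
    have h4 := mul_nonneg ht0.le (norm_nonneg (T (x n) - x n))
    linarith
  obtain ⟨y, hy⟩ := exists_tendsto_apply_of_surjective hrefl U fun n => hR _ (hzK n)
  have hyo : ‖y - o‖ ≤ d / 2 := by
    refine le_of_forall_pos_le_add fun e he => ?_
    refine norm_le_of_tendsto_apply (l := (U : Filter ℕ)) (x := fun n => z n - x n)
      (fun f => by simpa using (hy f).sub (ho f)) ?_
    filter_upwards [hTx0.eventually_lt_const (mul_pos ht0 he)] with n hn
    refine le_of_mul_le_mul_left ?_ ht0
    linarith [hzx n]
  choose f hf1 hfz using fun n => exists_dual_vector'' ℝ (z n - o)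
  obtain ⟨g, hg⟩ := exists_tendsto_apply_of_norm_le U hf1
  -- Choosing `m` through the weak-star limit `g` first lets a later `n` make both `f n (z m - y)`
  -- and `f m (z n - y)` less than `η`.
  obtain ⟨m, hm⟩ := ((hy g).eventually_lt_const (lt_add_of_pos_right (g y) hη0)).exists
  have hgm : g (z m - y) < η := by
    rw [map_sub]
    linarith
  obtain ⟨n, hn1, hn2⟩ := (((hg (z m - y)).eventually_lt_const hgm).and
    ((hy (f m)).eventually_lt_const (lt_add_of_pos_right (f m y) hη0))).exists
  have bound : ∀ k v, f k v ≤ ‖v‖ := fun k v => by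
    simpa using (le_abs_self _).trans ((f k).le_of_opNorm_le (hf1 k) v)
  have hzo' : ∀ k, d - η ≤ f k (z k - o) := fun k => by
    rw [hfz]
    exact hzo k
  have hn3 := hzo' n
  have hm3 := hzo' m
  rcases hs (z n - z m) (y - o) (d / 2) (hzz n m) hyo with h | h
  · have := bound n (z n - z m + (y - o))
    simp only [map_sub, map_add] at *
    linarith
  · have := bound m (-(z n - z m - (y - o)))
    rw [norm_neg] at this
    simp only [map_sub, map_neg] at *
    linarith
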